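/- Let $d\ge 0$ and let $P\subset\mathbb{R}^d$ be a lattice $d$-polytope, i.e. the convex hull of finitely many points of $\mathbb{Z}^d$ whose affine hull is $\mathbb{R}^d$, and let $\partial$ denote the (topological) boundary. Consider the formal power series $$\mathrm{Ehr}_P(z)=1+\sum_{m\ge 1}\bigl|mP\cap\mathbb{Z}^d\bigr|\,z^m,\qquad \mathrm{Ehr}_{\partial P}(z)=1+\sum_{m\ge 1}\bigl|\partial(mP)\cap\mathbb{Z}^d\bigr|\,z^m .$$ Then there are (unique) polynomials $h^*_P(z)=\sum_{i=0}^{d}h^*_i(P)z^i$ and $h^*_{\partial P}(z)=\sum_{i=0}^{d}h^*_i(\partial P)z^i$ with integer coefficients and degree at most $d$ such that $$\mathrm{Ehr}_P(z)=\frac{h^*_P(z)}{(1-z)^{d+1}},\qquad \mathrm{Ehr}_{\partial P}(z)=\frac{h^*_{\partial P}(z)}{(1-z)^{d}},$$ and, with the convention $h^*_{d+1}(P)=0$ and $h^*_{-1}(\partial P)=0$, for all $0\le i\le d$ $$h^*_i(P)-h^*_{d-i+1}(P)=h^*_i(\partial P)-h^*_{i-1}(\partial P).$$ -/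

import Mathlib

open scoped Pointwise

noncomputable section

namespace Ehrhart

/-- The inclusion of the lattice `ℤ^d` into `ℝ^d`. -/
def toReal {d : ℕ} (v : Fin d → ℤ) : Fin d → ℝ := fun j => (v j : ℝ)

/-- A lattice polytope in `ℝ^d`: the convex hull of finitely many points of `ℤ^d`. -/
def IsLatticePolytope {d : ℕ} (P : Set (Fin d → ℝ)) : Prop :=
  ∃ S : Finset (Fin d → ℤ), P = convexHull ℝ (toReal '' (S : Set (Fin d → ℤ)))

/-- A lattice `d`-polytope in `ℝ^d`: a lattice polytope whose affine hull is all of `ℝ^d`. -/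
def IsFullDimLatticePolytope {d : ℕ} (P : Set (Fin d → ℝ)) : Prop :=
  IsLatticePolytope P ∧ affineSpan ℝ P = ⊤

/-- The number of points of `ℤ^d` in a (bounded) set `A ⊆ ℝ^d`. -/
def latticeCount {d : ℕ} (A : Set (Fin d → ℝ)) : ℕ :=
  {v : Fin d → ℤ | toReal v ∈ A}.ncard

/-- The Ehrhart series `1 + ∑_{m ≥ 1} |mP ∩ ℤ^d| z^m` of `P`. -/
def ehrhartSeries {d : ℕ} (P : Set (Fin d → ℝ)) : PowerSeries ℤ :=
  PowerSeries.mk fun m => if m = 0 then 1 else (latticeCount ((m : ℝ) • P) : ℤ)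

/-- The Ehrhart series `1 + ∑_{m ≥ 1} |∂(mP) ∩ ℤ^d| z^m` of the boundary of `P`. -/
def boundaryEhrhartSeries {d : ℕ} (P : Set (Fin d → ℝ)) : PowerSeries ℤ :=
  PowerSeries.mk fun m => if m = 0 then 1 else (latticeCount (frontier ((m : ℝ) • P)) : ℤ)

/-- The `h^*`-polynomial of `P`: the part of degree at most `d` of `(1 - z)^(d+1) Ehr_P(z)`.
That nothing is cut off, that is `Ehr_P(z) = h^*_P(z) / (1 - z)^(d+1)`, is Ehrhart's theorem;
it is not assumed, and it is asserted wherever this definition is used in a statement. -/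
def hStar {d : ℕ} (P : Set (Fin d → ℝ)) : Polynomial ℤ :=
  PowerSeries.trunc (d + 1) ((1 - PowerSeries.X) ^ (d + 1) * ehrhartSeries P)

/-- The `h^*`-polynomial of `∂P`: the part of degree at most `d` of `(1 - z)^d Ehr_{∂P}(z)`.
As for `hStar`, that nothing is cut off is asserted wherever this is used in a statement. -/
def boundaryHStar {d : ℕ} (P : Set (Fin d → ℝ)) : Polynomial ℤ :=
  PowerSeries.trunc (d + 1) ((1 - PowerSeries.X) ^ d * boundaryEhrhartSeries P)

end Ehrhart

end

open Filter Topology PowerSeries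

/-! ### Lexicographic signs and multiplication by `1 - X` -/

namespace Ehrhart

/-! The theorem follows from Ehrhart–Macdonald reciprocity, proved by a half-open decomposition of
the cone over `P`. Generic weights on the generators `(1, s)` define a regular triangulation. Take a
generic `q = (1, p)` with `p` interior to `P`. A lattice point `(m, v)` lies in the cone iff `(m, v)
+ ε q` does for all small `ε > 0`, and in its interior iff `(m, v) - ε q` does. The perturbed point
avoids all walls, so it lies in exactly one cell. Thus both counts are disjoint sums over the same
simplicial cells, with opposite choices of the faces removed (`ncard_eq_sum_cellCount`).

In one cell, translation by the `d + 1` generators gives the factor `(1 - z)^(d+1)` and leaves the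
points of a half-open box (`one_sub_X_pow_mul_cellCount`). The reflection of the box in its centre
exchanges `q` and `-q` and sends height `k` to `d + 1 - k` (`cellCount_box_neg`). So if `h` gives
the numerator for `P`, then `h (d + 1 - m)` gives the one for the interior (`ehrhart_reciprocity`).

The boundary series is their difference, so `(1 - z)` times the boundary numerator has coefficients
`h m - h (d + 1 - m)`, which is the asserted identity. These are antisymmetric under `m ↦ d + 1 -
m`, hence their partial sums vanish beyond degree `d` and the boundary numerator is a polynomial. -/

/-- The number `a + ε * η` is positive for all small `ε > 0`. -/
def LexPos (a η : ℝ) : Prop := 0 < a ∨ (a = 0 ∧ 0 < η)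

lemma LexPos.nonneg {a η : ℝ} (h : LexPos a η) : 0 ≤ a := by
  rcases h with h | h
  · exact h.le
  · exact h.1.ge

lemma LexPos.add_one {a η : ℝ} (h : LexPos a η) : LexPos (a + 1) η :=
  Or.inl (by linarith [h.nonneg])

lemma le_one_of_not_lexPos {a η : ℝ} (h : ¬ LexPos (a - 1) η) : a ≤ 1 := by
  by_contra! h'
  exact h (Or.inl (by linarith))

/-- Lexicographic positivity is a total order on pairs: when `η ≠ 0` the pair is nonzero, so exactly
one of it and its negative is positive. -/
lemma lexPos_neg_iff {a η : ℝ} (hη : η ≠ 0) : LexPos a (-η) ↔ ¬ LexPos (-a) η := by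
  unfold LexPos
  rcases lt_trichotomy a 0 with h | h | h
  · simp [h.not_gt, h.ne, h]
  · subst h
    simp only [lt_self_iff_false, true_and, false_or, neg_zero, not_lt, Left.neg_pos_iff]
    exact ⟨le_of_lt, fun h => lt_of_le_of_ne h hη⟩
  · simp [h, h.not_gt, h.ne']

lemma eventually_pos_iff_lexPos (a : ℝ) {η : ℝ} (hη : η ≠ 0) :
    ∀ᶠ ε in 𝓝[>] (0 : ℝ), a + ε * η ≠ 0 ∧ (0 < a + ε * η ↔ LexPos a η) := by
  have hc : Tendsto (fun ε : ℝ => a + ε * η) (𝓝[>] 0) (𝓝 a) := by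
    have : Continuous fun ε : ℝ => a + ε * η := by fun_prop
    simpa using this.continuousWithinAt.tendsto (x := 0) (s := Set.Ioi 0)
  rcases lt_trichotomy a 0 with h | h | h
  · filter_upwards [hc.eventually_lt_const h] with ε hε
    refine ⟨hε.ne, ?_⟩
    simp [LexPos, hε.not_gt, h.not_gt, h.ne]
  · subst h
    filter_upwards [self_mem_nhdsWithin] with ε hε
    have hε : 0 < ε := hε
    simp [LexPos, hε, hε.ne', hη]
  · filter_upwards [hc.eventually_const_lt h] with ε hε
    refine ⟨hε.ne', ?_⟩
    simp [LexPos, hε, h]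

lemma one_sub_X_mul_mk {f g : ℤ → ℤ} (h0 : f (-1) = 0) (h : ∀ m, f m = g m + f (m - 1)) :
    (1 - X : PowerSeries ℤ) * PowerSeries.mk (fun m : ℕ => f m)
      = PowerSeries.mk (fun m : ℕ => g m) := by
  ext m
  rw [sub_mul, one_mul, map_sub]
  cases m with
  | zero =>
    have := h 0
    simp only [zero_sub, h0] at this
    simp [this]
  | succ m =>
    have := h ((m + 1 : ℕ) : ℤ)
    rw [coeff_succ_X_mul]
    simp only [coeff_mk, this]
    push_cast
    simp

/-! ### Half-open simplicial cones and their boxes -/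

section HalfOpen

variable {ι Λ : Type*} [AddCommGroup Λ]

/-- The lattice points of the cell in which the coordinates in `B` are lexicographically
positive, and those in `B \ J` are moreover restricted to a half-open unit interval. -/
def halfOpenCell (γ : ι → Λ →+ ℝ) (η : ι → ℝ) (B J : Finset ι) : Set Λ :=
  {x | (∀ i ∈ B, LexPos (γ i x) (η i)) ∧ ∀ i ∈ B, i ∉ J → ¬ LexPos (γ i x - 1) (η i)}

/-- The number of points of height `m` in a half-open cell. -/
noncomputable def cellCount (ht : Λ →+ ℤ) (γ : ι → Λ →+ ℝ) (η : ι → ℝ)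
    (B J : Finset ι) (m : ℤ) : ℤ :=
  ({x | x ∈ halfOpenCell γ η B J ∧ ht x = m}.ncard : ℤ)

lemma halfOpenCell_mono (γ : ι → Λ →+ ℝ) (η : ι → ℝ) (B : Finset ι) {J K : Finset ι} (h : J ⊆ K) :
    halfOpenCell γ η B J ⊆ halfOpenCell γ η B K :=
  fun _ hx => ⟨hx.1, fun i hi hiK => hx.2 i hi fun hJ => hiK (h hJ)⟩

variable {ht : Λ →+ ℤ} {γ : ι → Λ →+ ℝ} {η : ι → ℝ} {B : Finset ι} {w : ι → Λ}

/-- Split by whether the `j`-th coordinate exceeds 1 lexicographically. The points where it does not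
form the cell for `J`; the others are translates by `w j` of points one level lower. -/
lemma cellCount_insert [DecidableEq ι] {J : Finset ι} {j : ι} (hj : j ∈ B) (hjJ : j ∉ J)
    (hfin : ∀ m, {x | x ∈ halfOpenCell γ η B (insert j J) ∧ ht x = m}.Finite)
    (hw : ht (w j) = 1) (hγ : ∀ i ∈ B, γ i (w j) = if i = j then 1 else 0) (m : ℤ) :
    cellCount ht γ η B (insert j J) m
      = cellCount ht γ η B J m + cellCount ht γ η B (insert j J) (m - 1) := by
  have hset : {x | x ∈ halfOpenCell γ η B (insert j J) ∧ ht x = m}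
      = {x | x ∈ halfOpenCell γ η B J ∧ ht x = m} ∪
        (fun x => x + w j) '' {x | x ∈ halfOpenCell γ η B (insert j J) ∧ ht x = m - 1} := by
    ext x
    constructor
    · rintro ⟨⟨h1, h2⟩, h3⟩
      by_cases hx : LexPos (γ j x - 1) (η j)
      · right
        refine ⟨x - w j, ⟨⟨fun i hi => ?_, fun i hi hiJ => ?_⟩, ?_⟩, by simp⟩
        · rw [map_sub, hγ i hi]
          split_ifs with hij
          · subst hij; exact hx
          · simpa using h1 i hi
        · have hij : i ≠ j := fun h => hiJ (h ▸ Finset.mem_insert_self _ _)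
          rw [map_sub, hγ i hi, if_neg hij]
          simpa using h2 i hi hiJ
        · rw [map_sub, h3, hw]
      · left
        refine ⟨⟨h1, fun i hi hiJ => ?_⟩, h3⟩
        by_cases hij : i = j
        · subst hij; exact hx
        · exact h2 i hi (by simp [hij, hiJ])
    · rintro (⟨h1, h3⟩ | ⟨y, ⟨⟨h1, h2⟩, h3⟩, rfl⟩)
      · exact ⟨halfOpenCell_mono γ η B (Finset.subset_insert _ _) h1, h3⟩
      · refine ⟨⟨fun i hi => ?_, fun i hi hiJ => ?_⟩, ?_⟩
        · rw [map_add, hγ i hi]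
          split_ifs with hij
          · exact (h1 i hi).add_one
          · simpa using h1 i hi
        · have hij : i ≠ j := fun h => hiJ (h ▸ Finset.mem_insert_self _ _)
          rw [map_add, hγ i hi, if_neg hij]
          simpa using h2 i hi hiJ
        · rw [map_add, h3, hw]; ring
  have hdisj : Disjoint {x | x ∈ halfOpenCell γ η B J ∧ ht x = m}
      ((fun x => x + w j) '' {x | x ∈ halfOpenCell γ η B (insert j J) ∧ ht x = m - 1}) := by
    rw [Set.disjoint_left]
    rintro _ ⟨h1, -⟩ ⟨y, ⟨⟨h2, -⟩, -⟩, rfl⟩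
    refine h1.2 j hj hjJ ?_
    simpa [hγ j hj] using h2 j hj
  unfold cellCount
  rw [hset, Set.ncard_union_eq hdisj
    ((hfin m).subset fun x hx => ⟨halfOpenCell_mono γ η B (Finset.subset_insert _ _) hx.1, hx.2⟩)
    ((hfin _).image _), Set.ncard_image_of_injective _ (add_left_injective _)]
  push_cast
  rfl

lemma height_nonneg {J : Finset ι} {x : Λ} (hht : ∀ x, (ht x : ℝ) = ∑ i ∈ B, γ i x)
    (hx : x ∈ halfOpenCell γ η B J) : 0 ≤ ht x := by
  have : (0 : ℝ) ≤ ht x := by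
    rw [hht]
    exact Finset.sum_nonneg fun i hi => (hx.1 i hi).nonneg
  exact_mod_cast this

lemma cellCount_of_neg {J : Finset ι} (hht : ∀ x, (ht x : ℝ) = ∑ i ∈ B, γ i x) {m : ℤ}
    (hm : m < 0) : cellCount ht γ η B J m = 0 := by
  have : {x | x ∈ halfOpenCell γ η B J ∧ ht x = m} = ∅ := by
    ext x
    simp only [Set.mem_ofPred_eq, Set.mem_empty_iff_false, iff_false]
    rintro ⟨h1, h2⟩
    have := height_nonneg hht h1
    omega
  simp [cellCount, this]

lemma cellCount_box_of_gt (hht : ∀ x, (ht x : ℝ) = ∑ i ∈ B, γ i x) (hη : 0 < ∑ i ∈ B, η i)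
    {m : ℤ} (hm : (B.card : ℤ) ≤ m) : cellCount ht γ η B ∅ m = 0 := by
  have : {x | x ∈ halfOpenCell γ η B ∅ ∧ ht x = m} = ∅ := by
    ext x
    simp only [Set.mem_ofPred_eq, Set.mem_empty_iff_false, iff_false]
    rintro ⟨h1, h2⟩
    -- All coordinates are at most 1, and where `η i > 0` the value 1 itself is excluded; one such
    -- `i` makes the bound on the height strict.
    obtain ⟨i, hi, hηi⟩ : ∃ i ∈ B, 0 < η i := by
      by_contra! h
      exact hη.not_ge (Finset.sum_nonpos h)
    have hlt : (ht x : ℝ) < ∑ _i ∈ B, (1 : ℝ) := by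
      rw [hht]
      refine Finset.sum_lt_sum (fun k hk => le_one_of_not_lexPos (h1.2 k hk (by simp)))
        ⟨i, hi, lt_of_le_of_ne (le_one_of_not_lexPos (h1.2 i hi (by simp))) fun h => ?_⟩
      exact h1.2 i hi (by simp) (Or.inr ⟨by rw [h, sub_self], hηi⟩)
    rw [Finset.sum_const, nsmul_eq_mul, mul_one] at hlt
    have : ht x < B.card := by exact_mod_cast hlt
    omega
  simp [cellCount, this]

/-- Reflection `x ↦ ∑ w j - x` replaces each coordinate `a` by `1 - a`, which swaps the closed and
open ends of every unit interval, as does negating `η`. -/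
lemma cellCount_box_neg [DecidableEq ι] (hw : ∀ i ∈ B, ht (w i) = 1)
    (hγ : ∀ j ∈ B, ∀ i ∈ B, γ i (w j) = if i = j then 1 else 0)
    (hη : ∀ i ∈ B, η i ≠ 0) (m : ℤ) :
    cellCount ht γ (-η) B ∅ m = cellCount ht γ η B ∅ (B.card - m) := by
  have hs : ∀ i ∈ B, γ i (∑ j ∈ B, w j) = 1 := by
    intro i hi
    rw [map_sum, Finset.sum_congr rfl fun j hj => hγ j hj i hi]
    simp [hi]
  have hts : ht (∑ j ∈ B, w j) = B.card := by
    rw [map_sum, Finset.sum_congr rfl hw]; simp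
  have key : ∀ (η : ι → ℝ) (m : ℤ), (∀ i ∈ B, η i ≠ 0) →
      ∀ x, x ∈ halfOpenCell γ η B ∅ → ht x = m →
      (∑ j ∈ B, w j) - x ∈ halfOpenCell γ (-η) B ∅ ∧ ht ((∑ j ∈ B, w j) - x) = B.card - m := by
    intro η m hη x hx hm
    refine ⟨⟨fun i hi => ?_, fun i hi _ => ?_⟩, by rw [map_sub, hts, hm]⟩
    · rw [map_sub, hs i hi, Pi.neg_apply, lexPos_neg_iff (hη i hi), neg_sub]
      exact hx.2 i hi (by simp)
    · rw [map_sub, hs i hi, Pi.neg_apply, lexPos_neg_iff (hη i hi), not_not]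
      simpa using hx.1 i hi
  have hset : {x | x ∈ halfOpenCell γ (-η) B ∅ ∧ ht x = m}
      = (fun x => (∑ j ∈ B, w j) - x) '' {x | x ∈ halfOpenCell γ η B ∅ ∧ ht x = B.card - m} := by
    ext x
    constructor
    · rintro ⟨h1, h2⟩
      refine ⟨(∑ j ∈ B, w j) - x, ?_, by simp⟩
      have := key (-η) m (fun i hi => by simpa using hη i hi) x h1 h2
      rwa [neg_neg] at this
    · rintro ⟨y, ⟨h1, h2⟩, rfl⟩
      have := key η _ hη y h1 h2
      rwa [sub_sub_cancel] at this
  unfold cellCount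
  rw [hset, Set.ncard_image_of_injective _ (sub_right_injective)]

/-- Each factor `1 - X` confines one more coordinate to its unit interval, by `cellCount_insert`. -/
lemma one_sub_X_pow_mul_cellCount [DecidableEq ι] (hht : ∀ x, (ht x : ℝ) = ∑ i ∈ B, γ i x)
    (hw : ∀ i ∈ B, ht (w i) = 1)
    (hγ : ∀ j ∈ B, ∀ i ∈ B, γ i (w j) = if i = j then 1 else 0)
    (hfin : ∀ m, {x | x ∈ halfOpenCell γ η B B ∧ ht x = m}.Finite) :
    (1 - X : PowerSeries ℤ) ^ B.card * PowerSeries.mk (fun m : ℕ => cellCount ht γ η B B m)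
      = PowerSeries.mk (fun m : ℕ => cellCount ht γ η B ∅ m) := by
  have key : ∀ J : Finset ι, J ⊆ B → (1 - X : PowerSeries ℤ) ^ J.card *
      PowerSeries.mk (fun m : ℕ => cellCount ht γ η B J m)
      = PowerSeries.mk (fun m : ℕ => cellCount ht γ η B ∅ m) := by
    intro J
    induction J using Finset.induction_on with
    | empty => simp
    | insert j J hj ih =>
      intro hJ
      have hjB : j ∈ B := hJ (Finset.mem_insert_self _ _)
      rw [Finset.card_insert_of_notMem hj, pow_succ, mul_assoc,
        one_sub_X_mul_mk (g := cellCount ht γ η B J) (cellCount_of_neg hht (by norm_num))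
          (cellCount_insert hjB hj (fun m => (hfin m).subset fun x hx =>
            ⟨halfOpenCell_mono γ η B hJ hx.1, hx.2⟩) (hw j hjB) (hγ j hjB)),
        ih ((Finset.subset_insert _ _).trans hJ)]
  exact key B subset_rfl

end HalfOpen

/-! ### Regular triangulations from generic weights -/

section Triangulation

variable {ι E : Type*} [AddCommGroup E] [Module ℝ E]

/-- The index sets `B` for which the vectors `u i`, `i ∈ B`, form a basis. -/
def BasisSet (u : ι → E) : Type _ :=
  {B : Finset ι // LinearIndepOn ℝ u (B : Set ι) ∧ ⊤ ≤ Submodule.span ℝ (u '' (B : Set ι))}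

/-- The basis with a given index set. -/
noncomputable def BasisSet.basis {u : ι → E} (B : BasisSet u) : Module.Basis B.1 ℝ E :=
  Module.Basis.mk (v := fun i : B.1 => u i) B.2.1 (by
    refine B.2.2.trans (Submodule.span_mono ?_)
    rintro _ ⟨i, hi, rfl⟩
    exact ⟨⟨i, hi⟩, rfl⟩)

/-- The coordinates with respect to a basis, extended by zero. -/
noncomputable def BasisSet.coord {u : ι → E} (B : BasisSet u) (i : ι) : E →ₗ[ℝ] ℝ := by
  classical
  exact if h : i ∈ B.1 then B.basis.coord ⟨i, h⟩ else 0

variable {u : ι → E}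

lemma BasisSet.coord_of_notMem (B : BasisSet u) {i : ι} (h : i ∉ B.1) : B.coord i = 0 := by
  simp [BasisSet.coord, h]

lemma BasisSet.coord_apply_of_mem (B : BasisSet u) {i : ι} (h : i ∈ B.1) (y : E) :
    B.coord i y = B.basis.repr y ⟨i, h⟩ := by
  simp [BasisSet.coord, h]

lemma BasisSet.basis_apply (B : BasisSet u) (i : B.1) : B.basis i = u i := by
  exact Module.Basis.mk_apply B.2.1 _ i

lemma BasisSet.card_eq (B : BasisSet u) : B.1.card = Module.finrank ℝ E := by
  rw [Module.finrank_eq_card_basis B.basis, Fintype.card_coe]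

lemma BasisSet.sum_coord_finset (B : BasisSet u) (y : E) : ∑ i ∈ B.1, B.coord i y • u i = y := by
  conv_rhs => rw [← B.basis.sum_repr y]
  rw [← Finset.sum_coe_sort]
  refine Finset.sum_congr rfl fun i _ => ?_
  rw [B.coord_apply_of_mem i.2, B.basis_apply]

lemma BasisSet.coord_apply_self [DecidableEq ι] (B : BasisSet u) {i j : ι} (hj : j ∈ B.1) :
    B.coord i (u j) = if i = j then 1 else 0 := by
  by_cases hi : i ∈ B.1
  · rw [B.coord_apply_of_mem hi, ← B.basis_apply ⟨j, hj⟩, Module.Basis.repr_self]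
    simp only [Finsupp.single_apply, Subtype.mk.injEq, eq_comm]
  · have hij : i ≠ j := fun h => hi (h ▸ hj)
    rw [B.coord_of_notMem hi, if_neg hij]
    rfl

variable [Fintype ι]

noncomputable instance (u : ι → E) : Fintype (BasisSet u) := by
  classical
  exact inferInstanceAs (Fintype {B : Finset ι //
    LinearIndepOn ℝ u (B : Set ι) ∧ ⊤ ≤ Submodule.span ℝ (u '' (B : Set ι))})

lemma BasisSet.sum_coord (B : BasisSet u) (y : E) : ∑ i, B.coord i y • u i = y := by
  conv_rhs => rw [← B.sum_coord_finset y]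
  refine (Finset.sum_subset (Finset.subset_univ _) fun i _ hi => ?_).symm
  rw [B.coord_of_notMem hi, LinearMap.zero_apply, zero_smul]

lemma BasisSet.coord_sum_smul (B : BasisSet u) {l : ι → ℝ} (hl : ∀ i ∉ B.1, l i = 0) (i : ι) :
    B.coord i (∑ j, l j • u j) = l i := by
  classical
  by_cases hi : i ∈ B.1
  · rw [map_sum, Finset.sum_eq_single i]
    · rw [map_smul, B.coord_apply_self hi]; simp
    · intro j _ hj
      by_cases hjB : j ∈ B.1
      · rw [map_smul, B.coord_apply_self hjB, if_neg hj.symm, smul_zero]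
      · rw [hl j hjB, zero_smul, map_zero]
    · simp
  · rw [B.coord_of_notMem hi, hl i hi]
    rfl

/-- The value at `y` of the linear functional that takes the values `ω i` at `u i`, `i ∈ B`. -/
noncomputable def BasisSet.value (B : BasisSet u) (ω : ι → ℝ) : E →ₗ[ℝ] ℝ :=
  ∑ i, ω i • B.coord i

lemma BasisSet.value_apply (B : BasisSet u) (ω : ι → ℝ) (y : E) :
    B.value ω y = ∑ i, ω i * B.coord i y := by
  simp [BasisSet.value]

lemma BasisSet.value_self (B : BasisSet u) (ω : ι → ℝ) {j : ι} (hj : j ∈ B.1) :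
    B.value ω (u j) = ω j := by
  classical
  simp [B.value_apply, B.coord_apply_self hj]

/-- Every independent subfamily of a spanning family extends to a basis. -/
lemma exists_basisSet_superset (hu : Submodule.span ℝ (Set.range u) = ⊤) {I : Set ι}
    (hI : LinearIndepOn ℝ u I) : ∃ B : BasisSet u, I ⊆ (B.1 : Set ι) := by
  classical
  refine ⟨⟨(hI.extend (Set.subset_univ I)).toFinset, ?_, ?_⟩, ?_⟩
  · rw [Set.coe_toFinset]
    exact hI.linearIndepOn_extend _
  · rw [Set.coe_toFinset, hI.span_image_extend_eq_span_image, Set.image_univ, hu]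
  · rw [Set.coe_toFinset]
    exact hI.subset_extend _

/-- Weights that separate each vector from every basis that does not contain it. -/
lemma exists_generic_weights (u : ι → E) :
    ∃ ω : ι → ℝ, ∀ (B : BasisSet u) (j : ι), j ∉ B.1 → B.value ω (u j) ≠ ω j := by
  classical
  let f : {p : BasisSet u × ι // p.2 ∉ p.1.1} → Module.Dual ℝ (ι → ℝ) := fun p =>
    (∑ i, p.1.1.coord i (u p.1.2) • LinearMap.proj i) - LinearMap.proj p.1.2
  -- Finitely many nonzero functionals have a common point of non-vanishing. Each one here is
  -- nonzero because it takes the value `-1` at the `j`-th unit vector, `j ∉ B`.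
  obtain ⟨ω, hω⟩ := Module.Dual.exists_forall_ne_zero_of_forall_exists f (by
    rintro ⟨⟨B, j⟩, hj⟩
    refine ⟨Pi.single j 1, ?_⟩
    simp [f, Pi.single_apply, B.coord_of_notMem hj])
  refine ⟨ω, fun B j hj h => hω ⟨(B, j), hj⟩ ?_⟩
  simp only [f, LinearMap.sub_apply, LinearMap.sum_apply, LinearMap.smul_apply,
    LinearMap.proj_apply, smul_eq_mul, sub_eq_zero]
  rw [← h, B.value_apply]
  exact Finset.sum_congr rfl fun i _ => mul_comm _ _

/-- The cone generated by the vectors `u i`. -/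
def generatedCone (u : ι → E) : Set E := {y | ∃ l : ι → ℝ, (∀ i, 0 ≤ l i) ∧ ∑ i, l i • u i = y}

/-- A representation of minimal weight does not get lighter along a feasible direction. -/
lemma weight_nonneg_of_isMin {y : E} {ω l μ : ι → ℝ} (hl : ∀ i, 0 ≤ l i)
    (hly : ∑ i, l i • u i = y)
    (hmin : ∀ l' : ι → ℝ, (∀ i, 0 ≤ l' i) → ∑ i, l' i • u i = y →
      ∑ i, ω i * l i ≤ ∑ i, ω i * l' i)
    (hμ : ∑ i, μ i • u i = 0) (hpos : ∀ i, μ i < 0 → 0 < l i) : 0 ≤ ∑ i, ω i * μ i := by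
  have h1 : ∀ i, ∀ᶠ t in 𝓝[>] (0 : ℝ), 0 ≤ l i + t * μ i := by
    intro i
    by_cases h : μ i < 0
    · have hc : Continuous fun t : ℝ => l i + t * μ i := by fun_prop
      have := hc.continuousWithinAt.tendsto (x := 0) (s := Set.Ioi 0)
      simp only [zero_mul, add_zero] at this
      filter_upwards [this.eventually_const_lt (hpos i h)] with t ht using ht.le
    · filter_upwards [self_mem_nhdsWithin] with t ht
      have ht : 0 < t := ht
      have := mul_nonneg ht.le (not_lt.mp h)
      linarith [hl i]
  obtain ⟨t, ht, ht0⟩ := ((eventually_all.2 h1).and self_mem_nhdsWithin).exists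
  have ht0 : 0 < t := ht0
  have := hmin (fun i => l i + t * μ i) ht (by
    simp only [add_smul, mul_smul, Finset.sum_add_distrib, ← Finset.smul_sum, hly, hμ,
      smul_zero, add_zero])
  simp only [mul_add, Finset.sum_add_distrib] at this
  have h2 : ∑ i, ω i * (t * μ i) = t * ∑ i, ω i * μ i := by
    rw [Finset.mul_sum]
    exact Finset.sum_congr rfl fun i _ => by ring
  rw [h2] at this
  exact nonneg_of_mul_nonneg_right (by linarith) ht0

/-- The exchange direction that adds `u j` and removes its expansion in the basis `B`. -/
lemma exchange_sum [DecidableEq ι] (B : BasisSet u) (j : ι) :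
    ∑ i, ((Pi.single j 1 : ι → ℝ) i - B.coord i (u j)) • u i = 0 := by
  simp [sub_smul, Finset.sum_sub_distrib, B.sum_coord, Pi.single_apply]

lemma exchange_weight [DecidableEq ι] (B : BasisSet u) (ω : ι → ℝ) (j : ι) :
    ∑ i, ω i * ((Pi.single j 1 : ι → ℝ) i - B.coord i (u j)) = ω j - B.value ω (u j) := by
  simp [mul_sub, Finset.sum_sub_distrib, B.value_apply, Pi.single_apply]

/-- The index sets of the regular triangulation defined by the weights `ω`. -/
noncomputable def triangulation (u : ι → E) (ω : ι → ℝ) : Finset (BasisSet u) := by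
  classical
  exact Finset.univ.filter fun B => ∀ j, B.value ω (u j) ≤ ω j

lemma mem_triangulation {ω : ι → ℝ} {B : BasisSet u} :
    B ∈ triangulation u ω ↔ ∀ j, B.value ω (u j) ≤ ω j := by
  simp [triangulation]

/-- The coefficients of a representation of `y` are nonnegative with sum `ht y`, so the
representations form a compact set. -/
lemma exists_min_weight [TopologicalSpace E] [IsTopologicalAddGroup E] [ContinuousSMul ℝ E]
    [T2Space E] (ht : E →ₗ[ℝ] ℝ) (hht : ∀ i, ht (u i) = 1) {y : E} (hy : y ∈ generatedCone u)
    (ω : ι → ℝ) :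
    ∃ l : ι → ℝ, (∀ i, 0 ≤ l i) ∧ ∑ i, l i • u i = y ∧
      ∀ l' : ι → ℝ, (∀ i, 0 ≤ l' i) → ∑ i, l' i • u i = y →
        ∑ i, ω i * l i ≤ ∑ i, ω i * l' i := by
  let K : Set (ι → ℝ) := {l | (∀ i, 0 ≤ l i) ∧ ∑ i, l i • u i = y}
  have hK : IsCompact K := by
    refine (isCompact_univ_pi fun _ : ι => isCompact_Icc (a := (0 : ℝ)) (b := ht y)).of_isClosed_subset
      ?_ ?_
    · refine IsClosed.inter (s₁ := {l : ι → ℝ | ∀ i, 0 ≤ l i})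
        (s₂ := {l : ι → ℝ | ∑ i, l i • u i = y}) ?_ ?_
      · have : {l : ι → ℝ | ∀ i, 0 ≤ l i} = ⋂ i, {l | 0 ≤ l i} := by ext; simp
        rw [this]
        exact isClosed_iInter fun i => isClosed_le continuous_const (continuous_apply i)
      · exact isClosed_eq (by fun_prop) continuous_const
    · rintro l ⟨h1, h2⟩ i -
      refine ⟨h1 i, ?_⟩
      have : ht y = ∑ i, l i := by rw [← h2]; simp [hht]
      rw [this]
      exact Finset.single_le_sum (fun i _ => h1 i) (Finset.mem_univ i)
  obtain ⟨l, hl, hmin⟩ := hK.exists_isMinOn (f := fun l : ι → ℝ => ∑ i, ω i * l i) hy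
    (by fun_prop)
  exact ⟨l, hl.1, hl.2, fun l' h1 h2 => hmin ⟨h1, h2⟩⟩

/-- Linear programming: the support of a lightest representation of `y` spans the cell containing
`y`, and minimality along exchange directions is the inequality that defines the triangulation. -/
lemma exists_mem_triangulation [TopologicalSpace E] [IsTopologicalAddGroup E]
    [ContinuousSMul ℝ E] [T2Space E] (hu : Submodule.span ℝ (Set.range u) = ⊤)
    (ht : E →ₗ[ℝ] ℝ) (hht : ∀ i, ht (u i) = 1) {ω : ι → ℝ}
    (hω : ∀ (B : BasisSet u) (j : ι), j ∉ B.1 → B.value ω (u j) ≠ ω j)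
    {y : E} (hy : y ∈ generatedCone u) (hgen : ∀ (B : BasisSet u), ∀ i ∈ B.1, B.coord i y ≠ 0) :
    ∃ B ∈ triangulation u ω, ∀ i ∈ B.1, 0 < B.coord i y := by
  classical
  obtain ⟨l, hl, hly, hmin⟩ := exists_min_weight ht hht hy ω
  let s : Set ι := {i | 0 < l i}
  -- `I` is a maximal independent subset of the support `s`, so the vectors of the support lie in
  -- its span.
  have hI := (linearIndepOn_empty ℝ u).linearIndepOn_extend (Set.empty_subset s)
  set I := (linearIndepOn_empty ℝ u).extend (Set.empty_subset s) with hIdef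
  have hIs : I ⊆ s := LinearIndepOn.extend_subset _ _
  obtain ⟨B, hIB⟩ := exists_basisSet_superset hu hI
  have hspan : ∀ j ∈ s, ∀ i, B.coord i (u j) ≠ 0 → i ∈ I := by
    intro j hj i hij
    have h1 : u j ∈ Submodule.span ℝ (u '' I) :=
      LinearIndepOn.image_subset_span_image_extend _ _ ⟨j, hj, rfl⟩
    by_contra hi
    refine hij ?_
    have h2 : Submodule.span ℝ (u '' I) ≤ LinearMap.ker (B.coord i) := by
      rw [Submodule.span_le]
      rintro _ ⟨k, hk, rfl⟩
      have : i ≠ k := fun h => hi (h ▸ hk)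
      simp [B.coord_apply_self (hIB hk), this]
    exact h2 h1
  -- For `j` in the support but not in `B`, the exchange only involves indices of the support, so
  -- both it and its opposite are feasible. Its weight is then zero, against genericity.
  have hsB : ∀ j, 0 < l j → j ∈ B.1 := by
    intro j hj
    by_contra hjB
    have h1 := weight_nonneg_of_isMin hl hly hmin (exchange_sum B j) (fun i hi => by
      by_cases hij : i = j
      · exact hij ▸ hj
      · simp only [Pi.single_apply, hij, if_false, zero_sub, neg_lt_zero] at hi
        exact hIs (hspan j hj i hi.ne'))
    have h2 := weight_nonneg_of_isMin (μ := fun i => -((Pi.single j 1 : ι → ℝ) i - B.coord i (u j)))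
      hl hly hmin (by
        simp only [neg_smul, Finset.sum_neg_distrib, exchange_sum B j, neg_zero]) (fun i hi => by
      by_cases hij : i = j
      · exact hij ▸ hj
      · simp only [Pi.single_apply, hij, if_false, zero_sub, neg_neg] at hi
        exact hIs (hspan j hj i hi.ne))
    simp only [mul_neg, Finset.sum_neg_distrib] at h2
    rw [exchange_weight] at h1 h2
    exact hω B j hjB (by linarith)
  have hcoord : ∀ i, B.coord i y = l i := by
    intro i
    rw [← hly]
    refine B.coord_sum_smul (fun i hi => ?_) i
    exact le_antisymm (not_lt.mp fun h => hi (hsB i h)) (hl i)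
  have hpos : ∀ i ∈ B.1, 0 < B.coord i y := by
    intro i hi
    refine lt_of_le_of_ne ?_ (hgen B i hi).symm
    rw [hcoord]
    exact hl i
  refine ⟨B, mem_triangulation.2 fun j => ?_, hpos⟩
  by_cases hj : j ∈ B.1
  · exact (B.value_self ω hj).le
  -- All coordinates of `y` in `B` are now strictly positive, so every exchange direction is
  -- feasible.
  · have h1 := weight_nonneg_of_isMin hl hly hmin (exchange_sum B j) (fun i hi => by
      by_cases hij : i = j
      · subst hij
        simp [B.coord_of_notMem hj] at hi
        linarith
      · rw [← hcoord]
        refine hpos i ?_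
        by_contra hiB
        simp [hij, B.coord_of_notMem hiB] at hi)
    rw [exchange_weight] at h1
    linarith

lemma mem_generatedCone_of_coord_pos (B : BasisSet u) {y : E}
    (h : ∀ i ∈ B.1, 0 < B.coord i y) : y ∈ generatedCone u := by
  refine ⟨fun i => B.coord i y, fun i => ?_, B.sum_coord y⟩
  by_cases hi : i ∈ B.1
  · exact (h i hi).le
  · simp [B.coord_of_notMem hi]

/-- Expand `y` in `B'` with positive coefficients: the functional of `B` is at most `ω` on each
generator, while that of `B'` equals `ω` on `B'`. -/
lemma value_le_value_of_mem_triangulation {ω : ι → ℝ} {B B' : BasisSet u}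
    (hB : B ∈ triangulation u ω) {y : E} (h' : ∀ i ∈ B'.1, 0 < B'.coord i y) :
    B.value ω y ≤ B'.value ω y ∧ (B.value ω y = B'.value ω y →
      ∀ i ∈ B'.1, B.value ω (u i) = ω i) := by
  have h1 : B.value ω y = ∑ i ∈ B'.1, B'.coord i y * B.value ω (u i) := by
    conv_lhs => rw [← B'.sum_coord_finset y]
    simp
  have h2 : B'.value ω y = ∑ i ∈ B'.1, B'.coord i y * ω i := by
    conv_lhs => rw [← B'.sum_coord_finset y]
    rw [map_sum]
    refine Finset.sum_congr rfl fun i hi => ?_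
    rw [map_smul, B'.value_self ω hi, smul_eq_mul]
  have h3 : ∀ i ∈ B'.1, B'.coord i y * B.value ω (u i) ≤ B'.coord i y * ω i := fun i hi =>
    mul_le_mul_of_nonneg_left (mem_triangulation.1 hB i) (h' i hi).le
  rw [h1, h2]
  refine ⟨Finset.sum_le_sum h3, fun h i hi => ?_⟩
  exact mul_left_cancel₀ (h' i hi).ne' ((Finset.sum_eq_sum_iff_of_le h3).1 h i hi)

/-- The two functionals agree at the common point `y`, so each attains the weights on the other's
basis; by genericity this happens only on its own basis. -/
lemma eq_of_mem_triangulation {ω : ι → ℝ}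
    (hω : ∀ (B : BasisSet u) (j : ι), j ∉ B.1 → B.value ω (u j) ≠ ω j) {B B' : BasisSet u}
    (hB : B ∈ triangulation u ω) (hB' : B' ∈ triangulation u ω) {y : E}
    (h : ∀ i ∈ B.1, 0 < B.coord i y) (h' : ∀ i ∈ B'.1, 0 < B'.coord i y) : B = B' := by
  have h1 := value_le_value_of_mem_triangulation hB h'
  have h2 := value_le_value_of_mem_triangulation hB' h
  have h3 := h1.2 (le_antisymm h1.1 h2.1)
  have h4 := h2.2 (le_antisymm h2.1 h1.1)
  refine Subtype.ext (Finset.Subset.antisymm (fun i hi => ?_) fun i hi => ?_)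
  · by_contra hn
    exact hω B' i hn (h4 i hi)
  · by_contra hn
    exact hω B i hn (h3 i hi)

end Triangulation

/-! ### Perturbation in a generic direction -/

section GenericDirection

variable {ι E : Type*} [Fintype ι] [AddCommGroup E] [Module ℝ E] {u : ι → E}

lemma eventually_generic (q : E) (hq : ∀ (B : BasisSet u), ∀ i ∈ B.1, B.coord i q ≠ 0) (y : E) :
    ∀ᶠ ε in 𝓝[>] (0 : ℝ), ∀ (B : BasisSet u), ∀ i ∈ B.1, B.coord i (y + ε • q) ≠ 0 ∧
      (0 < B.coord i (y + ε • q) ↔ LexPos (B.coord i y) (B.coord i q)) := by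
  refine eventually_all.2 fun B => (eventually_all_finset B.1).2 fun i hi => ?_
  filter_upwards [eventually_pos_iff_lexPos (B.coord i y) (hq B i hi)] with ε hε
  simpa using hε

lemma exists_generic_direction (u : ι → E) :
    ∃ g : E, ∀ (B : BasisSet u), ∀ i ∈ B.1, B.coord i g ≠ 0 := by
  classical
  let f : {p : BasisSet u × ι // p.2 ∈ p.1.1} → Module.Dual ℝ E := fun p => p.1.1.coord p.1.2
  obtain ⟨g, hg⟩ := Module.Dual.exists_forall_ne_zero_of_forall_exists f (by
    rintro ⟨⟨B, j⟩, hj⟩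
    exact ⟨u j, by simp [f, B.coord_apply_self hj]⟩)
  exact ⟨g, fun B i hi => hg ⟨(B, i), hi⟩⟩

variable [TopologicalSpace E] [IsTopologicalAddGroup E] [ContinuousSMul ℝ E] [T2Space E]

lemma eventually_mem_generatedCone_iff (hu : Submodule.span ℝ (Set.range u) = ⊤)
    (ht : E →ₗ[ℝ] ℝ) (hht : ∀ i, ht (u i) = 1) {ω : ι → ℝ}
    (hω : ∀ (B : BasisSet u) (j : ι), j ∉ B.1 → B.value ω (u j) ≠ ω j)
    {q : E} (hq : ∀ (B : BasisSet u), ∀ i ∈ B.1, B.coord i q ≠ 0) (y : E) :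
    (∀ᶠ ε in 𝓝[>] (0 : ℝ), y + ε • q ∈ generatedCone u) ↔
      ∃ B ∈ triangulation u ω, ∀ i ∈ B.1, LexPos (B.coord i y) (B.coord i q) := by
  constructor
  · intro h
    obtain ⟨ε, h1, h2⟩ := (h.and (eventually_generic q hq y)).exists
    obtain ⟨B, hB, hB'⟩ := exists_mem_triangulation hu ht hht hω h1 fun B i hi => (h2 B i hi).1
    exact ⟨B, hB, fun i hi => (h2 B i hi).2.1 (hB' i hi)⟩
  · rintro ⟨B, -, hB⟩
    filter_upwards [eventually_generic q hq y] with ε hε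
    exact mem_generatedCone_of_coord_pos B fun i hi => (hε B i hi).2.2 (hB i hi)

omit [TopologicalSpace E] [IsTopologicalAddGroup E] [ContinuousSMul ℝ E] [T2Space E] in
lemma eq_of_lexPos {ω : ι → ℝ}
    (hω : ∀ (B : BasisSet u) (j : ι), j ∉ B.1 → B.value ω (u j) ≠ ω j)
    {q : E} (hq : ∀ (B : BasisSet u), ∀ i ∈ B.1, B.coord i q ≠ 0) {y : E} {B B' : BasisSet u}
    (hB : B ∈ triangulation u ω) (hB' : B' ∈ triangulation u ω)
    (h : ∀ i ∈ B.1, LexPos (B.coord i y) (B.coord i q))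
    (h' : ∀ i ∈ B'.1, LexPos (B'.coord i y) (B'.coord i q)) : B = B' := by
  obtain ⟨ε, hε⟩ := (eventually_generic q hq y).exists
  exact eq_of_mem_triangulation hω hB hB' (fun i hi => (hε B i hi).2.2 (h i hi))
    fun i hi => (hε B' i hi).2.2 (h' i hi)

end GenericDirection

/-! ### Lattice points counted cell by cell -/

section Count

variable {ι E Λ : Type*} [Fintype ι] [AddCommGroup E] [Module ℝ E] {u : ι → E} [AddCommGroup Λ]

/-- The coordinates of lattice points. -/
noncomputable def BasisSet.latticeCoord (B : BasisSet u) (emb : Λ →+ E) (i : ι) : Λ →+ ℝ :=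
  (B.coord i).toAddMonoidHom.comp emb

variable [TopologicalSpace E] [IsTopologicalAddGroup E] [ContinuousSMul ℝ E] [T2Space E]

lemma ncard_eq_sum_cellCount (hu : Submodule.span ℝ (Set.range u) = ⊤)
    (ht : E →ₗ[ℝ] ℝ) (hht : ∀ i, ht (u i) = 1) {ω : ι → ℝ}
    (hω : ∀ (B : BasisSet u) (j : ι), j ∉ B.1 → B.value ω (u j) ≠ ω j)
    {q : E} (hq : ∀ (B : BasisSet u), ∀ i ∈ B.1, B.coord i q ≠ 0) (emb : Λ →+ E) (htΛ : Λ →+ ℤ)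
    (m : ℤ)
    (hfin : {x | (∀ᶠ ε in 𝓝[>] (0 : ℝ), emb x + ε • q ∈ generatedCone u) ∧ htΛ x = m}.Finite) :
    (∀ B ∈ triangulation u ω, {x | x ∈ halfOpenCell (B.latticeCoord emb) (fun i => B.coord i q)
      B.1 B.1 ∧ htΛ x = m}.Finite) ∧
    ({x | (∀ᶠ ε in 𝓝[>] (0 : ℝ), emb x + ε • q ∈ generatedCone u) ∧ htΛ x = m}.ncard : ℤ)
      = ∑ B ∈ triangulation u ω,
          cellCount htΛ (B.latticeCoord emb) (fun i => B.coord i q) B.1 B.1 m := by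
  classical
  let D : BasisSet u → Set Λ := fun B =>
    {x | x ∈ halfOpenCell (B.latticeCoord emb) (fun i => B.coord i q) B.1 B.1 ∧ htΛ x = m}
  have hmem : ∀ B x, x ∈ D B ↔
      (∀ i ∈ B.1, LexPos (B.coord i (emb x)) (B.coord i q)) ∧ htΛ x = m := by
    intro B x
    -- With `J = B` no coordinate is bounded above.
    refine and_congr_left fun _ => ?_
    exact ⟨fun h => h.1, fun h => ⟨h, fun i hi hi' => absurd hi hi'⟩⟩
  have hD : ∀ B ∈ triangulation u ω, (D B).Finite := by
    intro B hB
    refine hfin.subset fun x hx => ⟨?_, hx.2⟩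
    exact (eventually_mem_generatedCone_iff hu ht hht hω hq _).2 ⟨B, hB, ((hmem B x).1 hx).1⟩
  refine ⟨hD, ?_⟩
  have hcard : ∀ B ∈ triangulation u ω,
      cellCount htΛ (B.latticeCoord emb) (fun i => B.coord i q) B.1 B.1 m
        = ((hfin.toFinset.filter (· ∈ D B)).card : ℤ) := by
    intro B hB
    unfold cellCount
    rw [← Set.ncard_coe_finset]
    congr 2
    ext x
    simp only [Finset.coe_filter, Set.Finite.mem_toFinset]
    constructor
    · intro hx
      exact ⟨⟨(eventually_mem_generatedCone_iff hu ht hht hω hq _).2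
        ⟨B, hB, ((hmem B x).1 hx).1⟩, hx.2⟩, hx⟩
    · exact fun hx => hx.2
  rw [Finset.sum_congr rfl hcard, ← Nat.cast_sum, ← Finset.card_biUnion,
    Set.ncard_eq_toFinset_card _ hfin]
  · congr 2
    ext x
    simp only [Finset.mem_biUnion, Finset.mem_filter, Set.Finite.mem_toFinset]
    constructor
    · intro hx
      obtain ⟨B, hB, h⟩ := (eventually_mem_generatedCone_iff hu ht hht hω hq _).1 hx.1
      exact ⟨B, hB, hx, (hmem B x).2 ⟨h, hx.2⟩⟩
    · rintro ⟨B, -, hx, -⟩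
      exact hx
  · intro B hB B' hB' hne
    rw [Function.onFun, Finset.disjoint_left]
    intro x hx hx'
    exact hne (eq_of_lexPos hω hq hB hB' ((hmem B x).1 (Finset.mem_filter.1 hx).2).1
      ((hmem B' x).1 (Finset.mem_filter.1 hx').2).1)

end Count

/-! ### Closed and open dilates through perturbation -/

section Dilates

variable {V : Type*} [NormedAddCommGroup V] [NormedSpace ℝ V] {P : Set V} {p : V}

/-- Forwards, dilates of a convex set add. Backwards, if `v + ε p = (m + ε) y` then `m y` is within
`2Rε` of `v`, and `m • P` is closed. -/
lemma mem_smul_iff_eventually (hc : Convex ℝ P) (hP : IsCompact P) (hp : p ∈ P) {m : ℝ}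
    (hm : 0 ≤ m) (v : V) :
    v ∈ m • P ↔ ∀ᶠ ε in 𝓝[>] (0 : ℝ), v + ε • p ∈ (m + ε) • P := by
  constructor
  · intro hv
    filter_upwards [self_mem_nhdsWithin] with ε hε
    rw [hc.add_smul hm (le_of_lt hε)]
    exact Set.add_mem_add hv (Set.smul_mem_smul_set hp)
  · intro h
    obtain ⟨R, hR⟩ := hP.isBounded.exists_norm_le
    have h1 : ∀ᶠ ε in 𝓝[>] (0 : ℝ), ∃ z ∈ m • P, ‖v - z‖ ≤ ε * (R + R) := by
      filter_upwards [h, self_mem_nhdsWithin] with ε hε hε0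
      have hε0 : 0 < ε := hε0
      obtain ⟨y, hy, hyv⟩ := hε
      refine ⟨m • y, Set.smul_mem_smul_set hy, ?_⟩
      have : v - m • y = ε • (y - p) := by
        have : v = (m + ε) • y - ε • p := by
          rw [show (m + ε) • y = v + ε • p from hyv]; simp
        rw [this, add_smul, smul_sub]; abel
      rw [this, norm_smul, Real.norm_of_nonneg hε0.le]
      exact mul_le_mul_of_nonneg_left ((norm_sub_le _ _).trans (add_le_add (hR y hy) (hR p hp)))
        hε0.le
    have hcl : IsClosed (m • P) := (hP.smul m).isClosed
    rw [← hcl.closure_eq, Metric.mem_closure_iff]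
    intro δ hδ
    have hc : Tendsto (fun ε : ℝ => ε * (R + R)) (𝓝[>] 0) (𝓝 0) := by
      have : Continuous fun ε : ℝ => ε * (R + R) := by fun_prop
      simpa using this.continuousWithinAt.tendsto (x := 0) (s := Set.Ioi 0)
    obtain ⟨ε, ⟨z, hz, hzv⟩, h2⟩ := (h1.and (hc.eventually_lt_const hδ)).exists
    exact ⟨z, hz, by rw [dist_eq_norm]; exact hzv.trans_lt h2⟩

lemma mem_interior_smul_iff_eventually (hc : Convex ℝ P) (hp : p ∈ interior P) {m : ℝ}
    (hm : 0 < m) (v : V) :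
    v ∈ interior (m • P) ↔ ∀ᶠ ε in 𝓝[>] (0 : ℝ), v - ε • p ∈ (m - ε) • P := by
  have hlt : ∀ᶠ ε in 𝓝[>] (0 : ℝ), ε < m :=
    (eventually_lt_nhds hm).filter_mono nhdsWithin_le_nhds
  constructor
  · intro hv
    rw [interior_smul₀ hm.ne', Set.mem_smul_set_iff_inv_smul_mem₀ hm.ne'] at hv
    have hcont : ContinuousAt (fun ε : ℝ => (m - ε)⁻¹ • (v - ε • p)) 0 := by
      refine ContinuousAt.smul (ContinuousAt.inv₀ (by fun_prop) (by simpa using hm.ne'))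
        (by fun_prop)
    have h1 : ∀ᶠ ε in 𝓝 (0 : ℝ), (m - ε)⁻¹ • (v - ε • p) ∈ interior P := by
      refine hcont.eventually_mem (isOpen_interior.mem_nhds ?_)
      simpa using hv
    filter_upwards [h1.filter_mono nhdsWithin_le_nhds, hlt] with ε h2 h3
    rw [Set.mem_smul_set_iff_inv_smul_mem₀ (sub_pos.2 h3).ne']
    exact interior_subset h2
  · intro h
    obtain ⟨ε, ⟨h1, h2⟩, h3⟩ := ((h.and hlt).and self_mem_nhdsWithin).exists
    have h3 : 0 < ε := h3
    -- The point `v = (v - ε p) + ε p` lies in this open set, which is contained in `(m - ε) • P + ε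
    -- • P = m • P`.
    have hopen : IsOpen ((m - ε) • P + ε • interior P) :=
      (isOpen_interior.smul₀ h3.ne').add_left
    refine interior_maximal ?_ hopen ⟨v - ε • p, h1, ε • p, Set.smul_mem_smul_set hp, by simp⟩
    calc (m - ε) • P + ε • interior P ⊆ (m - ε) • P + ε • P :=
          Set.add_subset_add_left (Set.smul_set_mono interior_subset)
      _ = m • P := by rw [← hc.add_smul (sub_pos.2 h2).le h3.le, sub_add_cancel]

end Dilates

/-! ### The cone over a lattice polytope -/

section Homogenization

variable {d : ℕ} (S : Finset (Fin d → ℤ))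

/-- The generators `(1, s)` of the cone over a lattice polytope. -/
def homog (i : S) : ℝ × (Fin d → ℝ) := (1, toReal i.1)

variable {S}

lemma span_homog (hS : affineSpan ℝ (toReal '' (S : Set (Fin d → ℤ))) = ⊤) :
    Submodule.span ℝ (Set.range (homog S)) = ⊤ := by
  set W := Submodule.span ℝ (Set.range (homog S)) with hW
  let f : (Fin d → ℝ) →ᵃ[ℝ] ℝ × (Fin d → ℝ) :=
    (AffineMap.const ℝ _ (1 : ℝ)).prod (AffineMap.id ℝ _)
  have h1 : ∀ w : Fin d → ℝ, ((1 : ℝ), w) ∈ W := by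
    have hle : affineSpan ℝ (toReal '' (S : Set (Fin d → ℤ))) ≤ W.toAffineSubspace.comap f := by
      rw [affineSpan_le]
      rintro _ ⟨s, hs, rfl⟩
      exact Submodule.subset_span ⟨⟨s, hs⟩, rfl⟩
    intro w
    have := hle (hS ▸ AffineSubspace.mem_top ℝ _ w)
    exact this
  rw [eq_top_iff]
  rintro ⟨t, w⟩ -
  have : ((t, w) : ℝ × (Fin d → ℝ)) = (t • ((1 : ℝ), (0 : Fin d → ℝ)) -
      ((1 : ℝ), (0 : Fin d → ℝ))) + (1, w) := by
    ext <;> simp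
  rw [this]
  exact W.add_mem (W.sub_mem (W.smul_mem _ (h1 0)) (h1 0)) (h1 w)

lemma sum_smul_homog (l : S → ℝ) :
    ∑ i, l i • homog S i = (∑ i, l i, ∑ i, l i • toReal i.1) := by
  ext <;> simp [homog, Prod.fst_sum, Prod.snd_sum]

lemma mem_generatedCone_homog (hS : (convexHull ℝ (toReal '' (S : Set (Fin d → ℤ)))).Nonempty)
    (t : ℝ) (w : Fin d → ℝ) : (t, w) ∈ generatedCone (homog S) ↔
      0 ≤ t ∧ w ∈ t • convexHull ℝ (toReal '' (S : Set (Fin d → ℤ))) := by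
  constructor
  · rintro ⟨l, hl, h⟩
    rw [sum_smul_homog, Prod.mk.injEq] at h
    obtain ⟨rfl, rfl⟩ := h
    refine ⟨Finset.sum_nonneg fun i _ => hl i, ?_⟩
    -- At height zero all coefficients vanish, and `0 • P = {0}` because `P` is nonempty; otherwise
    -- divide by the height.
    rcases (Finset.sum_nonneg fun i (_ : i ∈ Finset.univ) => hl i).eq_or_lt with h0 | h0
    · have hl0 : ∀ i, l i = 0 := fun i =>
        (Finset.sum_eq_zero_iff_of_nonneg fun i _ => hl i).1 h0.symm i (Finset.mem_univ i)
      rw [← h0, Set.zero_smul_set hS]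
      simp [hl0]
    · rw [Set.mem_smul_set_iff_inv_smul_mem₀ h0.ne', Finset.smul_sum]
      simp only [smul_smul]
      refine (convex_convexHull ℝ _).sum_mem (fun i _ => mul_nonneg (inv_nonneg.2 h0.le) (hl i)) ?_
        fun i _ => subset_convexHull ℝ _ ⟨i.1, i.2, rfl⟩
      rw [← Finset.mul_sum, inv_mul_cancel₀ h0.ne']
  · rintro ⟨ht, p, hp, rfl⟩
    have hsub : convexHull ℝ (toReal '' (S : Set (Fin d → ℤ)))
        ⊆ {p | ((1 : ℝ), p) ∈ generatedCone (homog S)} := by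
      refine convexHull_min ?_ ?_
      · rintro _ ⟨s, hs, rfl⟩
        classical
        refine ⟨Pi.single ⟨s, hs⟩ 1, fun i => ?_, ?_⟩
        · by_cases h : i = ⟨s, hs⟩ <;> simp [h]
        · simp [Pi.single_apply, homog]
      · rintro x ⟨l, hl, hx⟩ y ⟨l', hl', hy⟩ a b ha hb hab
        refine ⟨fun i => a * l i + b * l' i, fun i =>
          add_nonneg (mul_nonneg ha (hl i)) (mul_nonneg hb (hl' i)), ?_⟩
        simp only [add_smul, mul_smul, Finset.sum_add_distrib, ← Finset.smul_sum, hx, hy]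
        ext <;> simp [hab]
    obtain ⟨l, hl, h⟩ := hsub hp
    refine ⟨fun i => t * l i, fun i => mul_nonneg ht (hl i), ?_⟩
    simp only [mul_smul, ← Finset.smul_sum, h]
    ext <;> simp

lemma finite_latticePoints {A : Set (Fin d → ℝ)} (hA : Bornology.IsBounded A) :
    {v : Fin d → ℤ | toReal v ∈ A}.Finite := by
  obtain ⟨R, hR⟩ := hA.exists_norm_le
  refine (Set.finite_Icc (fun _ : Fin d => -⌈R⌉) (fun _ => ⌈R⌉)).subset fun v hv => ?_
  have h : ∀ j, |(v j : ℝ)| ≤ ⌈R⌉ := fun j =>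
    ((norm_le_pi_norm (toReal v) j).trans (hR _ hv)).trans (Int.le_ceil R)
  refine ⟨fun j => ?_, fun j => ?_⟩
  · have := (abs_le.1 (h j)).1
    exact_mod_cast this
  · have := (abs_le.1 (h j)).2
    exact_mod_cast this

end Homogenization

/-! ### Ehrhart's theorem, reciprocity and the boundary -/

section Reciprocity

variable {d : ℕ} {S : Finset (Fin d → ℤ)}

/-- The lattice `ℤ × ℤ^d` in `ℝ × ℝ^d`. -/
def latticeEmb (d : ℕ) : ℤ × (Fin d → ℤ) →+ ℝ × (Fin d → ℝ) where
  toFun x := (x.1, toReal x.2)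
  map_zero' := by ext <;> simp [toReal]
  map_add' x y := by ext <;> simp [toReal]

lemma latticeEmb_apply (x : ℤ × (Fin d → ℤ)) : latticeEmb d x = ((x.1 : ℝ), toReal x.2) := rfl

/-- Move `(1, p₀)` slightly in a generic direction and rescale to height 1: rescaling keeps the
coordinates nonzero, and the point stays in the open set `interior P`. -/
lemma exists_generic_interior_point {P : Set (Fin d → ℝ)} (hP : (interior P).Nonempty)
    (S : Finset (Fin d → ℤ)) :
    ∃ p ∈ interior P, ∀ (B : BasisSet (homog S)), ∀ i ∈ B.1, B.coord i ((1 : ℝ), p) ≠ 0 := by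
  obtain ⟨p₀, hp₀⟩ := hP
  obtain ⟨g, hg⟩ := exists_generic_direction (homog S)
  have h1 : ∀ᶠ t in 𝓝[>] (0 : ℝ), 0 < 1 + t * g.1 := by
    have : Continuous fun t : ℝ => 1 + t * g.1 := by fun_prop
    have := this.continuousWithinAt.tendsto (x := 0) (s := Set.Ioi 0)
    exact this.eventually_const_lt (by simp)
  have h2 : ∀ᶠ t in 𝓝 (0 : ℝ), (1 + t * g.1)⁻¹ • (p₀ + t • g.2) ∈ interior P := by
    have : ContinuousAt (fun t : ℝ => (1 + t * g.1)⁻¹ • (p₀ + t • g.2)) 0 := by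
      have h : ContinuousAt (fun t : ℝ => (1 + t * g.1)⁻¹) 0 :=
        ContinuousAt.inv₀ (by fun_prop) (by simp)
      exact h.smul (by fun_prop)
    refine this.eventually_mem (isOpen_interior.mem_nhds ?_)
    simpa using hp₀
  obtain ⟨t, ⟨h1, h2⟩, h3⟩ := ((h1.and (h2.filter_mono nhdsWithin_le_nhds)).and
    (eventually_generic g hg ((1 : ℝ), p₀))).exists
  refine ⟨_, h2, fun B i hi => ?_⟩
  have : ((1 : ℝ), (1 + t * g.1)⁻¹ • (p₀ + t • g.2))
      = (1 + t * g.1)⁻¹ • (((1 : ℝ), p₀) + t • g) := by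
    refine Prod.ext ?_ ?_
    · exact (inv_mul_cancel₀ h1.ne').symm
    · simp
  rw [this, map_smul]
  exact smul_ne_zero (inv_ne_zero h1.ne') (h3 B i hi).1

lemma homog_height (B : BasisSet (homog S)) (y : ℝ × (Fin d → ℝ)) :
    y.1 = ∑ i ∈ B.1, B.coord i y := by
  conv_lhs => rw [← B.sum_coord_finset y]
  simp [Prod.fst_sum, homog]

lemma BasisSet.card_homog (B : BasisSet (homog S)) : B.1.card = d + 1 := by
  rw [B.card_eq, Module.finrank_prod, Module.finrank_self, Module.finrank_fin_fun, add_comm]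

lemma latticeEmb_homog (i : S) : latticeEmb d (1, i.1) = homog S i := by
  simp [latticeEmb_apply, homog]

/-- The `h^*`-coefficients, as a sum of box counts over the cells of a triangulation. -/
noncomputable def boxSum (S : Finset (Fin d → ℤ)) (ω : S → ℝ) (q : ℝ × (Fin d → ℝ)) (k : ℤ) : ℤ :=
  ∑ B ∈ triangulation (homog S) ω,
    cellCount (AddMonoidHom.fst ℤ (Fin d → ℤ)) (B.latticeCoord (latticeEmb d))
      (fun i => B.coord i q) B.1 ∅ k

lemma height_eq_sum (B : BasisSet (homog S)) (x : ℤ × (Fin d → ℤ)) :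
    ((AddMonoidHom.fst ℤ (Fin d → ℤ) x : ℤ) : ℝ) = ∑ i ∈ B.1, B.latticeCoord (latticeEmb d) i x :=
  homog_height B (latticeEmb d x)

lemma latticeCoord_homog [DecidableEq S] (B : BasisSet (homog S)) :
    ∀ j ∈ B.1, ∀ i ∈ B.1, B.latticeCoord (latticeEmb d) i (1, j.1) = if i = j then 1 else 0 := by
  intro j hj i _
  change B.coord i (latticeEmb d (1, j.1)) = _
  rw [latticeEmb_homog, B.coord_apply_self hj]

lemma boxSum_of_neg (ω : S → ℝ) (q : ℝ × (Fin d → ℝ)) {k : ℤ} (hk : k < 0) :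
    boxSum S ω q k = 0 :=
  Finset.sum_eq_zero fun B _ => cellCount_of_neg (height_eq_sum B) hk

lemma boxSum_of_gt (ω : S → ℝ) {q : ℝ × (Fin d → ℝ)} (hq : 0 < q.1) {k : ℤ} (hk : (d : ℤ) < k) :
    boxSum S ω q k = 0 :=
  Finset.sum_eq_zero fun B _ => cellCount_box_of_gt (height_eq_sum B)
    (by rwa [← homog_height]) (by rw [B.card_homog]; push_cast; omega)

lemma boxSum_neg (ω : S → ℝ) {q : ℝ × (Fin d → ℝ)}
    (hq : ∀ (B : BasisSet (homog S)), ∀ i ∈ B.1, B.coord i q ≠ 0) (k : ℤ) :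
    boxSum S ω (-q) k = boxSum S ω q (d + 1 - k) := by
  classical
  refine Finset.sum_congr rfl fun B _ => ?_
  have := cellCount_box_neg (ht := AddMonoidHom.fst ℤ (Fin d → ℤ)) (w := fun j : S => (1, j.1))
    (fun _ _ => rfl) (latticeCoord_homog B) (hq B) k
  rw [B.card_homog] at this
  push_cast at this
  rw [← this]
  congr 1
  ext i
  simp

lemma one_sub_X_pow_mul_count (hS : affineSpan ℝ (toReal '' (S : Set (Fin d → ℤ))) = ⊤)
    {ω : S → ℝ}
    (hω : ∀ (B : BasisSet (homog S)) (j : S), j ∉ B.1 → B.value ω (homog S j) ≠ ω j)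
    {q : ℝ × (Fin d → ℝ)} (hq : ∀ (B : BasisSet (homog S)), ∀ i ∈ B.1, B.coord i q ≠ 0)
    {A : ℤ → Set (Fin d → ℤ)} (hfin : ∀ m, (A m).Finite)
    (hA : ∀ m v, (∀ᶠ ε in 𝓝[>] (0 : ℝ), latticeEmb d (m, v) + ε • q ∈ generatedCone (homog S)) ↔
      v ∈ A m) :
    (1 - X : PowerSeries ℤ) ^ (d + 1) * PowerSeries.mk (fun m : ℕ => ((A m).ncard : ℤ))
      = PowerSeries.mk (fun m : ℕ => boxSum S ω q m) := by
  classical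
  have hset : ∀ m : ℤ, {x : ℤ × (Fin d → ℤ) | (∀ᶠ ε in 𝓝[>] (0 : ℝ),
      latticeEmb d x + ε • q ∈ generatedCone (homog S)) ∧ AddMonoidHom.fst ℤ (Fin d → ℤ) x = m}
      = (fun v => (m, v)) '' A m := by
    intro m
    ext ⟨k, v⟩
    constructor
    · rintro ⟨h1, rfl⟩
      exact ⟨v, (hA _ v).1 h1, rfl⟩
    · rintro ⟨v, hv, h⟩
      obtain ⟨rfl, rfl⟩ := Prod.mk.injEq _ _ _ _ ▸ h
      exact ⟨(hA _ _).2 hv, rfl⟩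
  have hcount := fun m : ℤ => ncard_eq_sum_cellCount (span_homog hS) (LinearMap.fst ℝ ℝ _)
    (fun _ => rfl) hω hq (latticeEmb d) (AddMonoidHom.fst ℤ (Fin d → ℤ)) m
    (by rw [hset]; exact (hfin m).image _)
  have h1 : PowerSeries.mk (fun m : ℕ => ((A m).ncard : ℤ))
      = ∑ B ∈ triangulation (homog S) ω, PowerSeries.mk (fun m : ℕ =>
        cellCount (AddMonoidHom.fst ℤ (Fin d → ℤ)) (B.latticeCoord (latticeEmb d))
          (fun i => B.coord i q) B.1 B.1 m) := by
    ext m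
    have := (hcount m).2
    rw [hset, Set.ncard_image_of_injective _ (Prod.mk_right_injective _)] at this
    simp [this]
  have h2 : PowerSeries.mk (fun m : ℕ => boxSum S ω q m)
      = ∑ B ∈ triangulation (homog S) ω, PowerSeries.mk (fun m : ℕ =>
        cellCount (AddMonoidHom.fst ℤ (Fin d → ℤ)) (B.latticeCoord (latticeEmb d))
          (fun i => B.coord i q) B.1 ∅ m) := by
    ext m
    simp [boxSum]
  rw [h1, h2, Finset.mul_sum]
  refine Finset.sum_congr rfl fun B hB => ?_
  rw [← one_sub_X_pow_mul_cellCount (w := fun j : S => (1, j.1)) (height_eq_sum B)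
    (fun _ _ => rfl) (latticeCoord_homog B) (fun m => (hcount m).1 B hB), B.card_homog]

lemma eventually_add_mem_cone {p : Fin d → ℝ}
    (hp : p ∈ convexHull ℝ (toReal '' (S : Set (Fin d → ℤ)))) (m : ℤ) (v : Fin d → ℤ) :
    (∀ᶠ ε in 𝓝[>] (0 : ℝ), latticeEmb d (m, v) + ε • ((1 : ℝ), p) ∈ generatedCone (homog S)) ↔
      0 ≤ m ∧ toReal v ∈ (m : ℝ) • convexHull ℝ (toReal '' (S : Set (Fin d → ℤ))) := by
  have hcomp : IsCompact (convexHull ℝ (toReal '' (S : Set (Fin d → ℤ)))) :=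
    (S.finite_toSet.image _).isCompact_convexHull ℝ
  have heq : ∀ ε : ℝ, latticeEmb d (m, v) + ε • ((1 : ℝ), p) = (m + ε, toReal v + ε • p) := by
    intro ε
    simp [latticeEmb_apply]
  simp only [heq, mem_generatedCone_homog ⟨p, hp⟩]
  by_cases hm : 0 ≤ m
  · have hm' : (0 : ℝ) ≤ m := by exact_mod_cast hm
    rw [mem_smul_iff_eventually (convex_convexHull ℝ _) hcomp hp hm']
    simp only [hm, true_and]
    refine eventually_congr ?_
    filter_upwards [self_mem_nhdsWithin] with ε hε
    have : 0 ≤ m + ε := add_nonneg hm' (le_of_lt hε)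
    simp [this]
  · simp only [hm, false_and, iff_false]
    intro h
    -- As `m` is an integer, a negative height stays negative after adding `ε < 1`.
    have hm' : (m : ℝ) + 1 ≤ 0 := by exact_mod_cast (by omega : m + 1 ≤ 0)
    have hlt : ∀ᶠ ε in 𝓝[>] (0 : ℝ), ε < 1 :=
      (eventually_lt_nhds (one_pos (α := ℝ))).filter_mono nhdsWithin_le_nhds
    obtain ⟨ε, ⟨h1, -⟩, h2⟩ := (h.and hlt).exists
    linarith

/-- Moving by `-ε q` lowers the height, so the apex level `m = 0` is lost here, whereas
`eventually_add_mem_cone` keeps it. -/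
lemma eventually_sub_mem_cone {p : Fin d → ℝ}
    (hp : p ∈ interior (convexHull ℝ (toReal '' (S : Set (Fin d → ℤ))))) (m : ℤ)
    (v : Fin d → ℤ) :
    (∀ᶠ ε in 𝓝[>] (0 : ℝ), latticeEmb d (m, v) + ε • -((1 : ℝ), p) ∈ generatedCone (homog S)) ↔
      0 < m ∧ toReal v ∈ interior ((m : ℝ) • convexHull ℝ (toReal '' (S : Set (Fin d → ℤ)))) := by
  have heq : ∀ ε : ℝ, latticeEmb d (m, v) + ε • -((1 : ℝ), p) = (m - ε, toReal v - ε • p) := by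
    intro ε
    simp [latticeEmb_apply, sub_eq_add_neg]
  simp only [heq, mem_generatedCone_homog ⟨p, interior_subset hp⟩]
  by_cases hm : 0 < m
  · have hm' : (0 : ℝ) < m := by exact_mod_cast hm
    rw [mem_interior_smul_iff_eventually (convex_convexHull ℝ _) hp hm']
    simp only [hm, true_and]
    have hlt : ∀ᶠ ε in 𝓝[>] (0 : ℝ), ε < (m : ℝ) :=
      (eventually_lt_nhds hm').filter_mono nhdsWithin_le_nhds
    refine eventually_congr ?_
    filter_upwards [hlt] with ε hε
    simp [hε.le]
  · simp only [hm, false_and, iff_false]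
    intro h
    have hm' : (m : ℝ) ≤ 0 := by exact_mod_cast not_lt.1 hm
    obtain ⟨ε, ⟨h1, -⟩, h2⟩ := (h.and self_mem_nhdsWithin).exists
    have h2 : 0 < ε := h2
    linarith

/-- The Ehrhart series `∑_{m ≥ 1} |int(mP) ∩ ℤ^d| z^m` of the interior of `P`. -/
noncomputable def interiorEhrhartSeries (P : Set (Fin d → ℝ)) : PowerSeries ℤ :=
  PowerSeries.mk fun m => if m = 0 then 0 else (latticeCount (interior ((m : ℝ) • P)) : ℤ)

/-- **Ehrhart's theorem** and **Ehrhart–Macdonald reciprocity**. -/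
theorem ehrhart_reciprocity {P : Set (Fin d → ℝ)} (hP : IsFullDimLatticePolytope P) :
    ∃ h : ℤ → ℤ, (∀ k < 0, h k = 0) ∧ (∀ k, (d : ℤ) < k → h k = 0) ∧
      (1 - X) ^ (d + 1) * ehrhartSeries P = PowerSeries.mk (fun m : ℕ => h m) ∧
      (1 - X) ^ (d + 1) * interiorEhrhartSeries P
        = PowerSeries.mk (fun m : ℕ => h (d + 1 - m)) := by
  obtain ⟨⟨S, rfl⟩, hspan⟩ := hP
  rw [affineSpan_convexHull] at hspan
  obtain ⟨ω, hω⟩ := exists_generic_weights (homog S)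
  obtain ⟨p, hp, hq⟩ := exists_generic_interior_point
    (interior_convexHull_nonempty_iff_affineSpan_eq_top.2 hspan) S
  set P := convexHull ℝ (toReal '' (S : Set (Fin d → ℤ))) with hPdef
  have hne : P.Nonempty := ⟨p, interior_subset hp⟩
  have hbdd : ∀ m : ℝ, Bornology.IsBounded (m • P) := fun m =>
    (((S.finite_toSet.image _).isCompact_convexHull ℝ).smul m).isBounded
  refine ⟨boxSum S ω (1, p), fun k => boxSum_of_neg ω _, fun k => boxSum_of_gt ω one_pos, ?_, ?_⟩
  · rw [← one_sub_X_pow_mul_count hspan hω hq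
      (A := fun m => {v | 0 ≤ m ∧ toReal v ∈ (m : ℝ) • P})
      (fun m => (finite_latticePoints (hbdd m)).subset fun v hv => hv.2)
      (fun m v => eventually_add_mem_cone (interior_subset hp) m v)]
    congr 1
    ext m
    rw [ehrhartSeries, coeff_mk, coeff_mk]
    split_ifs with hm
    · subst hm
      -- The apex of the cone accounts for the constant term 1.
      have : {v : Fin d → ℤ | (0 : ℤ) ≤ (0 : ℕ) ∧ toReal v ∈ (((0 : ℕ) : ℤ) : ℝ) • P} = {0} := by
        ext v
        simp [Set.zero_smul_set hne, toReal, funext_iff]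
      rw [this, Set.ncard_singleton, Nat.cast_one]
    · simp [latticeCount]
  · have := one_sub_X_pow_mul_count hspan hω (q := -((1 : ℝ), p))
      (fun B i hi => by rw [map_neg]; exact neg_ne_zero.2 (hq B i hi))
      (A := fun m => {v | 0 < m ∧ toReal v ∈ interior ((m : ℝ) • P)})
      (fun m => (finite_latticePoints (hbdd m)).subset fun v hv => interior_subset (s := (_ : ℝ) • P) hv.2)
      (fun m v => eventually_sub_mem_cone hp m v)
    simp only [boxSum_neg ω hq] at this
    rw [← this]
    congr 1
    ext m
    rw [interiorEhrhartSeries, coeff_mk, coeff_mk]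
    split_ifs with hm
    · simp [hm]
    · simp [latticeCount, Nat.pos_of_ne_zero hm]

lemma latticeCount_frontier {A : Set (Fin d → ℝ)} (hA : IsCompact A) :
    (latticeCount (frontier A) : ℤ) = latticeCount A - latticeCount (interior A) := by
  have hsub : {v : Fin d → ℤ | toReal v ∈ interior A} ⊆ {v | toReal v ∈ A} :=
    fun v hv => interior_subset (s := A) hv
  have hset : {v : Fin d → ℤ | toReal v ∈ frontier A}
      = {v | toReal v ∈ A} \ {v | toReal v ∈ interior A} := by
    rw [hA.isClosed.frontier_eq]
    rfl
  have := Set.ncard_sdiff_add_ncard_of_subset hsub (finite_latticePoints hA.isBounded)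
  rw [latticeCount, latticeCount, latticeCount, hset]
  omega

lemma boundaryEhrhartSeries_eq {P : Set (Fin d → ℝ)} (hP : IsFullDimLatticePolytope P) :
    boundaryEhrhartSeries P = ehrhartSeries P - interiorEhrhartSeries P := by
  obtain ⟨⟨S, rfl⟩, -⟩ := hP
  ext m
  rw [map_sub, boundaryEhrhartSeries, ehrhartSeries, interiorEhrhartSeries, coeff_mk, coeff_mk,
    coeff_mk]
  split_ifs
  · simp
  · exact latticeCount_frontier (((S.finite_toSet.image _).isCompact_convexHull ℝ).smul _)

/-- A power series whose product with `1 - X` has antisymmetric coefficients is a polynomial. -/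
lemma coeff_eq_zero_of_one_sub_X_mul {F : PowerSeries ℤ} {h : ℤ → ℤ} (h0 : ∀ k < 0, h k = 0)
    (hd : ∀ k, (d : ℤ) < k → h k = 0)
    (hF : (1 - X) * F = PowerSeries.mk (fun m : ℕ => h m - h (d + 1 - m))) {n : ℕ} (hn : d < n) :
    coeff n F = 0 := by
  have hsum : ∀ n, coeff n F = ∑ j ∈ Finset.range (n + 1), (h j - h (d + 1 - j)) := by
    intro n
    induction n with
    | zero =>
      have := congrArg (coeff 0) hF
      simpa [sub_mul] using this
    | succ n ih =>
      have := congrArg (coeff (n + 1)) hF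
      rw [sub_mul, one_mul, map_sub, coeff_succ_X_mul, coeff_mk] at this
      rw [Finset.sum_range_succ, ← ih]
      linarith
  induction n, hn using Nat.le_induction with
  | base =>
    -- The sum over `0 ≤ j ≤ d + 1` is invariant under `j ↦ d + 1 - j`, so the two halves cancel.
    have := Finset.sum_range_reflect (fun j : ℕ => h j) (d + 1 + 1)
    rw [hsum, Finset.sum_sub_distrib, sub_eq_zero, ← this]
    refine Finset.sum_congr rfl fun j hj => ?_
    have := Finset.mem_range.1 hj
    congr 1
    omega
  | succ n hn ih =>
    -- Past degree `d + 1` each new term is zero: one index exceeds `d` and the other is negative.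
    rw [hsum, Finset.sum_range_succ, ← hsum, ih, hd _ (by push_cast; omega),
      h0 _ (by push_cast; omega)]
    rfl

lemma eq_coe_trunc {F : PowerSeries ℤ} {n : ℕ} (h : ∀ m, n ≤ m → coeff m F = 0) :
    F = (trunc n F : PowerSeries ℤ) := by
  ext m
  rw [Polynomial.coeff_coe, coeff_trunc]
  split_ifs with hm
  · rfl
  · exact h m (not_lt.1 hm)

end Reciprocity

end Ehrhart

theorem mainTheorem4 (d : ℕ) (P : Set (Fin d → ℝ))
    (hP : Ehrhart.IsFullDimLatticePolytope P) :
    (1 - PowerSeries.X) ^ (d + 1) * Ehrhart.ehrhartSeries P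
        = (Ehrhart.hStar P : PowerSeries ℤ) ∧
    (1 - PowerSeries.X) ^ d * Ehrhart.boundaryEhrhartSeries P
        = (Ehrhart.boundaryHStar P : PowerSeries ℤ) ∧
    ∀ i : ℕ, i ≤ d →
      (Ehrhart.hStar P).coeff i - (Ehrhart.hStar P).coeff (d + 1 - i)
        = (Ehrhart.boundaryHStar P).coeff i
          - (if i = 0 then 0 else (Ehrhart.boundaryHStar P).coeff (i - 1)) := by
  obtain ⟨h, h0, hd, h1, h2⟩ := Ehrhart.ehrhart_reciprocity hP
  have hF : (1 - PowerSeries.X) * ((1 - PowerSeries.X) ^ d * Ehrhart.boundaryEhrhartSeries P)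
      = PowerSeries.mk (fun m : ℕ => h m - h (d + 1 - m)) := by
    rw [← mul_assoc, ← pow_succ', Ehrhart.boundaryEhrhartSeries_eq hP, mul_sub, h1, h2]
    ext m
    simp
  have hcoe := Ehrhart.eq_coe_trunc (n := d + 1)
    (F := (1 - PowerSeries.X) ^ (d + 1) * Ehrhart.ehrhartSeries P) fun m hm => by
      rw [h1, PowerSeries.coeff_mk]
      exact hd _ (by omega)
  have hcoe' := Ehrhart.eq_coe_trunc (n := d + 1)
    (F := (1 - PowerSeries.X) ^ d * Ehrhart.boundaryEhrhartSeries P) fun m hm =>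
      Ehrhart.coeff_eq_zero_of_one_sub_X_mul h0 hd hF hm
  refine ⟨hcoe, hcoe', fun i hi => ?_⟩
  have hcoeff : ∀ k : ℕ, (Ehrhart.hStar P).coeff k = h k := fun k => by
    rw [← Polynomial.coeff_coe, Ehrhart.hStar, ← hcoe, h1, PowerSeries.coeff_mk]
  have hcoeff' : ∀ k : ℕ, (Ehrhart.boundaryHStar P).coeff k
      = PowerSeries.coeff k ((1 - PowerSeries.X) ^ d * Ehrhart.boundaryEhrhartSeries P) :=
    fun k => by rw [← Polynomial.coeff_coe, Ehrhart.boundaryHStar, ← hcoe']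
  have hi' := congrArg (PowerSeries.coeff i) hF
  rw [PowerSeries.coeff_mk, sub_mul, one_mul, map_sub, ← hcoeff'] at hi'
  -- At `i = 0` the index is `d + 1`, where the truncated polynomial has coefficient zero, as the
  -- convention demands.
  rw [hcoeff, hcoeff, Nat.cast_sub (by omega)]
  push_cast
  rw [← hi']
  cases i with
  | zero => simp
  | succ i => rw [PowerSeries.coeff_succ_X_mul, ← hcoeff']; simp
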